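/- Let $A$ be a locally compact (Hausdorff) commutative topological group, written additively, and let $\widehat{A}$ be its dual group, i.e. the group of continuous homomorphisms from $A$ into the multiplicative group ${\bf T}$ of complex numbers of modulus $1$. (1) Let $H$ be a (regular) Haar measure on $A$. If $\theta \in L^1(A, H)$ is not equal to $0$ $H$-almost everywhere, then its Fourier transform $$\widehat{\theta}(\phi) = \int_A \theta(x)\, \overline{\phi(x)} \, dH(x)$$ satisfies $\widehat{\theta}(\phi) \ne 0$ for some $\phi \in \widehat{A}$. (2) If $\nu$ is a nonzero regular complex Borel measure on $A$ (that is, a complex Borel measure whose total variation measure $|\nu|$ is regular), then its Fourier transform $$\widehat{\nu}(\phi) = \int_A \overline{\phi(x)} \, d\nu(x)$$ satisfies $\widehat{\nu}(\phi) \ne 0$ for some $\phi \in \widehat{A}$. (3) The continuous characters separate the points of $A$: if $a, b \in A$ and $a \ne b$, then there is a $\phi \in \widehat{A}$ such that $\phi(a) \ne \phi(b)$. -/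

import Mathlib

open MeasureTheory

namespace LCAFourier

variable {A : Type*} [AddCommGroup A] [TopologicalSpace A]

/-- The dual group `Â` of an additively written topological group `A`: the continuous
homomorphisms from `A` into the multiplicative group of complex numbers of modulus `1`.
`Multiplicative A` is `A` itself, with its operation written multiplicatively. -/
abbrev Dual (A : Type*) [AddCommGroup A] [TopologicalSpace A] : Type _ :=
  PontryaginDual (Multiplicative A)

/-- The value `φ(a)`, as a complex number, of a character `φ` at `a`. -/
noncomputable def eval (φ : Dual A) (a : A) : ℂ := ((φ (Multiplicative.ofAdd a) : Circle) : ℂ)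

theorem eval_zero (φ : Dual A) : eval φ 0 = 1 := by simp [eval]

theorem eval_add (φ : Dual A) (a b : A) : eval φ (a + b) = eval φ a * eval φ b := by
  simp [eval]

theorem norm_eval (φ : Dual A) (a : A) : ‖eval φ a‖ = 1 :=
  Circle.norm_coe _

theorem continuous_eval (φ : Dual A) : Continuous (eval φ) :=
  continuous_subtype_val.comp ((map_continuous φ).comp continuous_ofAdd)

variable [MeasurableSpace A]

/-- The Fourier transform `θ̂(φ) = ∫ θ(x) conj(φ(x)) dH(x)` of a function `θ` on `A`. -/
noncomputable def fourierFun (H : Measure A) (θ : A → ℂ) (φ : Dual A) : ℂ :=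
  ∫ x, θ x * starRingEnd ℂ (eval φ x) ∂H

theorem integrable_fourierFun [OpensMeasurableSpace A] {H : Measure A} {θ : A → ℂ}
    (hθ : Integrable θ H) (φ : Dual A) :
    Integrable (fun x => θ x * starRingEnd ℂ (eval φ x)) H :=
  hθ.mul_bdd (c := 1) (Complex.continuous_conj.comp (continuous_eval φ)).aestronglyMeasurable
    (Filter.Eventually.of_forall fun x => by simp [norm_eval])

/-- A complex Borel measure is regular when its total variation measure `|ν|` is. -/
def IsRegularComplex (ν : ComplexMeasure A) : Prop := ν.variation.Regular

/-- The Fourier transform `ν̂(φ) = ∫ conj(φ(x)) dν(x)` of a complex measure `ν` on `A`. -/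
noncomputable def fourierMeas (ν : ComplexMeasure A) (φ : Dual A) : ℂ :=
  ν.integral (fun x => starRingEnd ℂ (eval φ x)) (ContinuousLinearMap.mul ℝ ℂ)

/-- The total variation measure of a complex measure is finite. -/
theorem isFiniteMeasure_variation {X : Type*} [MeasurableSpace X] (ν : ComplexMeasure X) :
    IsFiniteMeasure ν.variation := by
  have h : ν.variation ≤ (ComplexMeasure.re ν).totalVariation +
      (ComplexMeasure.im ν).totalVariation := by
    refine VectorMeasure.variation_le_of_forall_enorm_le fun s hs => ?_
    have h1 : ν s = (((ν s).re : ℝ) : ℂ) + (((ν s).im : ℝ) : ℂ) * Complex.I :=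
      (Complex.re_add_im _).symm
    rw [h1, Measure.add_apply]
    refine (enorm_add_le _ _).trans (add_le_add ?_ ?_)
    · rw [show ‖(((ν s).re : ℝ) : ℂ)‖ₑ = ‖(ν s).re‖ₑ by simp [enorm_eq_nnnorm]]
      exact SignedMeasure.enorm_le_totalVariation (ComplexMeasure.re ν) s
    · rw [show ‖(((ν s).im : ℝ) : ℂ) * Complex.I‖ₑ = ‖(ν s).im‖ₑ by simp [enorm_eq_nnnorm]]
      exact SignedMeasure.enorm_le_totalVariation (ComplexMeasure.im ν) s
  exact isFiniteMeasure_of_le _ h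

theorem integrable_fourierMeas [OpensMeasurableSpace A] (ν : ComplexMeasure A) (φ : Dual A) :
    ν.Integrable (fun x => starRingEnd ℂ (eval φ x)) := by
  have := isFiniteMeasure_variation ν
  exact Integrable.of_bound
    (Complex.continuous_conj.comp (continuous_eval φ)).aestronglyMeasurable 1
    (Filter.Eventually.of_forall fun x => by simp [norm_eval])

end LCAFourier

/-! The regular representation `π` of `A` on `L²(H)` generates a commutative von Neumann algebra. By
Gelfand theory some character `χ` of it is nonzero on any given `X ≠ 0`, and `a ↦ χ (π a)` is a
unimodular homomorphism. It need not be continuous, since `π` is only strongly continuous.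

The remedy is to choose `Y = ∫ f π dH` with `f ∈ L¹(H)` and `Y * X ≠ 0`, and to apply Gelfand theory
to `Y * X`. Translation is continuous in `L¹(H)`, so `a ↦ π a * Y` is norm-continuous, and `χ (π a)
= χ (π a * Y) / χ Y` is continuous. The same trick makes `χ` commute with strong integrals `∫ h π
dμ` (`map_smear_eq_integral`). This gives `exists_dual_of_mem_vonNeumann`.

Taking `X = π a - π b` gives (3). Taking `X = ∫ h π dμ`, nonzero by
`ae_eq_zero_of_smear_regularRep_eq_zero`, gives (1) with `μ = H`, and (2) with `μ = |ν|` through the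
polar decomposition `ν = h |ν|`, `|h| = 1`. -/

namespace LCAFourier

open Set Filter Topology

/-! ### Gelfand theory and double commutants -/

section Gelfand

variable {R : Type*} [CStarAlgebra R]

/-- The characters of a closed commutative star subalgebra of a C⋆-algebra separate its points
from `0`. -/
theorem exists_starAlgHom_ne_zero (B : StarSubalgebra ℂ R) (hB : IsClosed (B : Set R))
    (hcomm : ∀ x ∈ B, ∀ y ∈ B, x * y = y * x) {x : B} (hx : x ≠ 0) :
    ∃ χ : B →⋆ₐ[ℂ] ℂ, Continuous χ ∧ χ x ≠ 0 := by
  have : IsClosed (B : Set R) := hB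
  let : CommCStarAlgebra B :=
    { StarSubalgebra.cstarAlgebra B with
      mul_comm := fun a b => Subtype.ext (hcomm a a.2 b b.2) }
  have h : WeakDual.gelfandTransform ℂ B x ≠ 0 := fun h =>
    hx ((gelfandTransform_isometry B).injective (h.trans (map_zero _).symm))
  obtain ⟨χ, hχ⟩ := DFunLike.ne_iff.1 h
  exact ⟨{ AlgHomClass.toAlgHom χ with map_star' := fun a => map_star χ a },
    map_continuous χ, hχ⟩

/-- The double commutant of a commutative star-closed set is commutative. -/
theorem mul_comm_of_mem_centralizer_centralizer {s : Set R}
    (hs : ∀ x ∈ s, ∀ y ∈ s, x * y = y * x) (hstar : star s = s) :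
    ∀ x ∈ StarSubalgebra.centralizer ℂ (StarSubalgebra.centralizer ℂ s : Set R),
    ∀ y ∈ StarSubalgebra.centralizer ℂ (StarSubalgebra.centralizer ℂ s : Set R),
      x * y = y * x := by
  have h : (StarSubalgebra.centralizer ℂ (StarSubalgebra.centralizer ℂ s : Set R) : Set R) =
      s.centralizer.centralizer := by
    rw [StarSubalgebra.coe_centralizer_centralizer, hstar, union_self]
  intro x hx y hy
  rw [← SetLike.mem_coe, h] at hx hy
  exact Set.centralizer_centralizer_comm_of_comm hs x hx y hy

end Gelfand

/-! ### Vector-valued measurability and regular measures -/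

section Measurability

variable {X E : Type*} [TopologicalSpace X] [T2Space X] [MeasurableSpace X] [BorelSpace X]
  [NormedAddCommGroup E] {μ : Measure X}

/-- `E` may be nonseparable, so continuity alone is not enough. Up to a null set `s` is a countable
union of compacts, whose images are separable. -/
theorem aestronglyMeasurable_restrict_of_continuous [μ.InnerRegularCompactLTTop] {F : X → E}
    (hF : Continuous F) {s : Set X} (hs : MeasurableSet s) (hμ : μ s ≠ ⊤) :
    AEStronglyMeasurable F (μ.restrict s) := by
  have h : ∀ n : ℕ, ∃ K ⊆ s, IsCompact K ∧ μ (s \ K) < ((n : ENNReal) + 1)⁻¹ := fun n =>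
    hs.exists_isCompact_sdiff_lt hμ (ENNReal.inv_ne_zero.2 (by finiteness))
  choose K hKs hK hlt using h
  have hae : s =ᵐ[μ] ⋃ n, K n := by
    refine (ae_eq_set).2 ⟨?_, by simp [sdiff_eq_empty.2 (iUnion_subset hKs)]⟩
    refine le_antisymm (ENNReal.le_of_forall_pos_le_add fun ε hε _ => ?_) bot_le
    obtain ⟨n, hn⟩ := ENNReal.exists_inv_nat_lt (a := ε) (by exact_mod_cast hε.ne')
    rw [zero_add]
    calc μ (s \ ⋃ n, K n) ≤ μ (s \ K n) := by gcongr; exact subset_iUnion K n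
      _ ≤ ((n : ENNReal) + 1)⁻¹ := (hlt n).le
      _ ≤ (n : ENNReal)⁻¹ := by gcongr; exact le_self_add
      _ ≤ ε := hn.le
  rw [Measure.restrict_congr_set hae, aestronglyMeasurable_iUnion_iff]
  exact fun n => hF.continuousOn.aestronglyMeasurable_of_isCompact (hK n) (hK n).measurableSet

variable [NormedSpace ℂ E]

/-- `h` vanishes a.e. off a σ-finite set, which is cut into pieces of finite measure. -/
theorem aestronglyMeasurable_smul_of_continuous [μ.InnerRegularCompactLTTop] {h : X → ℂ}
    (hh : Integrable h μ) {F : X → E} (hF : Continuous F) :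
    AEStronglyMeasurable (fun x => h x • F x) μ := by
  have hfin := hh.aefinStronglyMeasurable
  set t := hfin.sigmaFiniteSet
  have ht : MeasurableSet t := hfin.measurableSet
  have h0 : (fun x => h x • F x) =ᵐ[μ] t.indicator fun x => h x • F x := by
    have := (ae_restrict_iff' ht.compl).1 hfin.ae_eq_zero_compl
    filter_upwards [this] with x hx
    by_cases hxt : x ∈ t
    · simp [hxt]
    · simp [hxt, hx hxt]
  refine AEStronglyMeasurable.congr ?_ h0.symm
  rw [aestronglyMeasurable_indicator_iff ht]
  refine hh.aestronglyMeasurable.restrict.smul ?_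
  set S := spanningSets (μ.restrict t)
  have hu : t = ⋃ n, t ∩ S n := by rw [← inter_iUnion, iUnion_spanningSets, inter_univ]
  rw [hu, aestronglyMeasurable_iUnion_iff]
  intro n
  refine aestronglyMeasurable_restrict_of_continuous hF
    (ht.inter (measurableSet_spanningSets _ n)) ?_
  have := measure_spanningSets_lt_top (μ.restrict t) n
  rw [Measure.restrict_apply (measurableSet_spanningSets _ n), inter_comm] at this
  exact this.ne

theorem integrable_smul_of_continuous [μ.InnerRegularCompactLTTop] {h : X → ℂ}
    (hh : Integrable h μ) {F : X → E} (hF : Continuous F) {C : ℝ} (hC : ∀ x, ‖F x‖ ≤ C) :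
    Integrable (fun x => h x • F x) μ := by
  refine (hh.norm.mul_const C).mono' (aestronglyMeasurable_smul_of_continuous hh hF)
    (Eventually.of_forall fun x => ?_)
  rw [norm_smul]
  exact mul_le_mul_of_nonneg_left (hC x) (norm_nonneg _)

/-- An integrable function which is orthogonal to all continuous functions with compact support
vanishes almost everywhere. -/
theorem ae_eq_zero_of_forall_integral_mul_eq_zero [LocallyCompactSpace X] [μ.Regular] {h : X → ℂ}
    (hh : Integrable h μ)
    (H : ∀ g : X → ℂ, Continuous g → HasCompactSupport g → ∫ x, h x * g x ∂μ = 0) :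
    h =ᵐ[μ] 0 := by
  refine hh.ae_eq_zero_of_forall_setIntegral_eq_zero fun s hs hμs => ?_
  refine norm_le_zero_iff.1 (le_of_forall_pos_le_add fun ε hε => ?_)
  -- Absolute continuity of `∫ ‖h‖`: replacing the indicator of `s` by a bump `g` changes the
  -- integral only on `U \ K`, of measure below `δ`.
  obtain ⟨δ, hδ, hδ'⟩ := exists_pos_setLIntegral_lt_of_measure_lt (μ := μ)
    (f := fun x => ‖h x‖ₑ) hh.2.ne (ε := ENNReal.ofReal ε) (by simpa using hε)
  have hδ2 : δ / 2 ≠ 0 := (ENNReal.half_pos hδ.ne').ne'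
  obtain ⟨K, hKs, hK, hKlt⟩ := hs.exists_isCompact_sdiff_lt hμs.ne hδ2
  obtain ⟨U, hsU, hU, -, hUlt⟩ := hs.exists_isOpen_sdiff_lt hμs.ne hδ2
  obtain ⟨g, hg1, hgc, hgU, hg01⟩ :=
    exists_continuousMap_one_of_isCompact_subset_isOpen hK hU (hKs.trans hsU)
  have hgC : Continuous fun x => (g x : ℂ) := by fun_prop
  have hint : Integrable (fun x => h x * (g x : ℂ)) μ :=
    hh.mul_bdd (c := 1)
      (hgC.stronglyMeasurable_of_hasCompactSupport
        (HasCompactSupport.comp_left (g := fun r : ℝ => (r : ℂ)) hgc (by simp))).aestronglyMeasurable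
      (Eventually.of_forall fun x => by
        simpa [abs_of_nonneg (hg01 x).1] using (hg01 x).2)
  have h1 : ∫ x in s, h x ∂μ = ∫ x, (s.indicator h x - h x * (g x : ℂ)) ∂μ := by
    rw [integral_sub (hh.indicator hs) hint, integral_indicator hs, H _ hgC
      (HasCompactSupport.comp_left (g := fun r : ℝ => (r : ℂ)) hgc (by simp)), sub_zero]
  have hW : μ (U \ K) < δ := by
    calc μ (U \ K) ≤ μ (U \ s ∪ s \ K) := measure_mono fun x hx => by
          by_cases hxs : x ∈ s
          · exact Or.inr ⟨hxs, hx.2⟩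
          · exact Or.inl ⟨hx.1, hxs⟩
      _ ≤ μ (U \ s) + μ (s \ K) := measure_union_le _ _
      _ < δ / 2 + δ / 2 := ENNReal.add_lt_add hUlt hKlt
      _ = δ := ENNReal.add_halves δ
  have hWm : MeasurableSet (U \ K) := hU.measurableSet.diff hK.measurableSet
  rw [h1, zero_add]
  refine (norm_integral_le_lintegral_norm _).trans
    (ENNReal.toReal_le_of_le_ofReal hε.le (le_trans ?_ (hδ' _ hW).le))
  rw [← lintegral_indicator hWm]
  refine lintegral_mono fun x => ?_
  rw [ofReal_norm]
  by_cases hxK : x ∈ K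
  · simp [hKs hxK, hg1 hxK]
  by_cases hxU : x ∈ U
  · rw [indicator_of_mem (show x ∈ U \ K from ⟨hxU, hxK⟩)]
    obtain ⟨h0, h1⟩ := hg01 x
    have : ‖s.indicator h x - h x * (g x : ℂ)‖ ≤ ‖h x‖ := by
      by_cases hxs : x ∈ s
      · rw [indicator_of_mem hxs,
          show h x - h x * (g x : ℂ) = h x * ((1 - g x : ℝ) : ℂ) by push_cast; ring,
          norm_mul, Complex.norm_real, Real.norm_of_nonneg (by linarith)]
        exact mul_le_of_le_one_right (norm_nonneg _) (by linarith)
      · rw [indicator_of_notMem hxs, zero_sub, norm_neg, norm_mul, Complex.norm_real,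
          Real.norm_of_nonneg h0]
        exact mul_le_of_le_one_right (norm_nonneg _) h1
    exact enorm_le_iff_norm_le.2 this
  · have hxs : x ∉ s := fun h => hxU (hsU h)
    have : g x = 0 := image_eq_zero_of_notMem_tsupport fun h => hxU (hgU h)
    simp [hxs, this]

end Measurability

/-! ### Unitary representations and their von Neumann algebras -/

section UnitaryRepresentation

variable {A E : Type*} [AddCommGroup A] [NormedAddCommGroup E] [InnerProductSpace ℂ E]
  [CompleteSpace E] (π : Multiplicative A →* unitary (E →L[ℂ] E))

/-- The operator by which `a` acts in the unitary representation `π`. -/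
noncomputable def act (a : A) : E →L[ℂ] E := π (Multiplicative.ofAdd a)

theorem act_zero : act π 0 = 1 := by simp [act]

theorem act_add (a b : A) : act π (a + b) = act π a * act π b := by simp [act]

theorem act_add_apply (a b : A) (v : E) : act π (a + b) v = act π a (act π b v) := by
  simp [act_add]

theorem act_comm (a b : A) : act π a * act π b = act π b * act π a := by
  rw [← act_add, add_comm, act_add]

theorem star_act (a : A) : star (act π a) = act π (-a) := by
  rw [act, act, ofAdd_neg, map_inv, ← Unitary.star_eq_inv, Unitary.coe_star]

theorem norm_act_apply (a : A) (v : E) : ‖act π a v‖ = ‖v‖ :=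
  (Unitary.linearIsometryEquiv (π (Multiplicative.ofAdd a))).norm_map v

/-- The von Neumann algebra generated by a unitary representation. -/
noncomputable def vonNeumann : StarSubalgebra ℂ (E →L[ℂ] E) :=
  StarSubalgebra.centralizer ℂ (StarSubalgebra.centralizer ℂ (range (act π)) : Set (E →L[ℂ] E))

theorem star_range_act : star (range (act π)) = range (act π) := by
  ext x
  rw [Set.mem_star]
  constructor
  · rintro ⟨a, ha⟩
    exact ⟨-a, by rw [← star_act, ha, star_star]⟩
  · rintro ⟨a, rfl⟩
    exact ⟨-a, (star_act π a).symm⟩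

theorem isClosed_vonNeumann : IsClosed (vonNeumann π : Set (E →L[ℂ] E)) :=
  Set.isClosed_centralizer _

theorem mul_comm_of_mem_vonNeumann :
    ∀ x ∈ vonNeumann π, ∀ y ∈ vonNeumann π, x * y = y * x :=
  mul_comm_of_mem_centralizer_centralizer
    (by rintro _ ⟨a, rfl⟩ _ ⟨b, rfl⟩; exact act_comm π a b) (star_range_act π)

/-- The commutant is star-closed, so the condition on adjoints is automatic. -/
theorem mem_vonNeumann_of_forall {T : E →L[ℂ] E}
    (hT : ∀ Y : E →L[ℂ] E, (∀ a, act π a * Y = Y * act π a) → Y * T = T * Y) :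
    T ∈ vonNeumann π := by
  have h : ∀ Y ∈ StarSubalgebra.centralizer ℂ (range (act π)), Y * T = T * Y := fun Y hY =>
    hT Y fun a => ((StarSubalgebra.mem_centralizer_iff ℂ).1 hY _ ⟨a, rfl⟩).1
  exact (StarSubalgebra.mem_centralizer_iff ℂ).2 fun Y hY => ⟨h Y hY, h _ (star_mem hY)⟩

theorem act_mem_vonNeumann (a : A) : act π a ∈ vonNeumann π :=
  mem_vonNeumann_of_forall π fun _ hY => (hY a).symm

variable {π} [TopologicalSpace A]

/-- The continuous character of `A` obtained by restricting a character of the von Neumann algebra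
to the group, provided that the group acts norm-continuously on an operator which the character
does not kill. -/
theorem exists_dual_eq {χ : vonNeumann π →⋆ₐ[ℂ] ℂ} (hχ : Continuous χ) {Y : vonNeumann π}
    (hχY : χ Y ≠ 0) (hY : Continuous fun a => act π a * (Y : E →L[ℂ] E)) :
    ∃ φ : Dual A, ∀ a, eval φ a = χ ⟨act π a, act_mem_vonNeumann π a⟩ := by
  set u : A → vonNeumann π := fun a => ⟨act π a, act_mem_vonNeumann π a⟩ with hu
  have hadd : ∀ a b, χ (u (a + b)) = χ (u a) * χ (u b) := fun a b => by
    rw [← map_mul]; congr 1; exact Subtype.ext (act_add π a b)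
  have hzero : χ (u 0) = 1 := by
    rw [← map_one χ]; congr 1; exact Subtype.ext (act_zero π)
  have hstar : ∀ a, star (χ (u a)) = χ (u (-a)) := fun a => by
    rw [← map_star]; congr 1; exact Subtype.ext (star_act π a)
  have hnorm : ∀ a, ‖χ (u a)‖ = 1 := fun a => by
    have h : χ (u a) * star (χ (u a)) = 1 := by rw [hstar, ← hadd, add_neg_cancel, hzero]
    have h2 : ‖χ (u a)‖ * ‖χ (u a)‖ = 1 := by
      rw [← CStarRing.norm_self_mul_star, h, norm_one]
    nlinarith [norm_nonneg (χ (u a))]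
  have hcont : Continuous fun a => χ (u a) := by
    have h : Continuous fun a => χ (u a * Y) := hχ.comp (hY.subtype_mk fun a => (u a * Y).2)
    have h2 : (fun a => χ (u a)) = fun a => χ (u a * Y) / χ Y := by
      ext a; rw [map_mul, mul_div_cancel_right₀ _ hχY]
    rw [h2]
    exact h.div_const _
  refine ⟨{ toFun := fun a => ⟨χ (u a.toAdd), mem_sphere_zero_iff_norm.2 (hnorm _)⟩
            map_one' := Subtype.ext hzero
            map_mul' := fun a b => Subtype.ext (hadd _ _)
            continuous_toFun := (hcont.comp continuous_toAdd).subtype_mk _ }, fun a => rfl⟩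

end UnitaryRepresentation

/-! ### Strong integrals of a representation -/

section Smear

variable {A E : Type*} [AddCommGroup A] [TopologicalSpace A] [T2Space A]
  [MeasurableSpace A] [BorelSpace A] [NormedAddCommGroup E] [InnerProductSpace ℂ E]
  [CompleteSpace E] {π : Multiplicative A →* unitary (E →L[ℂ] E)}
  (hπ : ∀ v, Continuous fun a => act π a v) {μ : Measure A} [μ.InnerRegularCompactLTTop]
  {h : A → ℂ} (hh : Integrable h μ)

theorem integrable_smul_act {π : Multiplicative A →* unitary (E →L[ℂ] E)}
    (hπ : ∀ v, Continuous fun a => act π a v) {h : A → ℂ} (hh : Integrable h μ) (v : E) : Integrable (fun a => h a • act π a v) μ :=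
  integrable_smul_of_continuous hh (hπ v) fun a => (norm_act_apply π a v).le

/-- The operator `∫ h(a) π(a) dμ(a)`, the integral being taken in the strong sense. -/
noncomputable def smear : E →L[ℂ] E :=
  LinearMap.mkContinuous
    { toFun := fun v => ∫ a, h a • act π a v ∂μ
      map_add' := fun v w => by
        simp only [map_add, smul_add]
        exact integral_add (integrable_smul_act hπ hh v) (integrable_smul_act hπ hh w)
      map_smul' := fun c v => by
        simp only [map_smul, smul_comm _ c, RingHom.id_apply]
        exact integral_smul c _ }
    (∫ a, ‖h a‖ ∂μ) fun v => by
      refine (norm_integral_le_integral_norm _).trans_eq ?_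
      simp only [norm_smul, norm_act_apply]
      exact integral_mul_const _ _

theorem smear_apply (v : E) : smear hπ hh v = ∫ a, h a • act π a v ∂μ := rfl

/-- Bounded operators pass through the integral. The double commutant is used because a strong
integral need not be a norm limit. -/
theorem smear_mem_vonNeumann : smear hπ hh ∈ vonNeumann π := by
  refine mem_vonNeumann_of_forall π fun Y hY => ContinuousLinearMap.ext fun v => ?_
  rw [mul_apply_eq_comp, mul_apply_eq_comp, smear_apply, smear_apply,
    ← Y.integral_comp_comm (integrable_smul_act hπ hh v)]
  refine integral_congr_ae (Eventually.of_forall fun a => ?_)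
  have := DFunLike.congr_fun (hY a) v
  simp only [mul_apply_eq_comp] at this
  simp [this]

/-- A character of the von Neumann algebra maps the smeared operator to the corresponding integral
of the character. -/
theorem map_smear_eq_integral {χ : vonNeumann π →⋆ₐ[ℂ] ℂ} (hχ : Continuous χ) {Y : vonNeumann π}
    (hχY : χ Y ≠ 0) (hY : Continuous fun a => act π a * (Y : E →L[ℂ] E)) :
    χ ⟨smear hπ hh, smear_mem_vonNeumann hπ hh⟩ =
      ∫ a, h a * χ ⟨act π a, act_mem_vonNeumann π a⟩ ∂μ := by
  have : CompleteSpace (vonNeumann π) := (isClosed_vonNeumann π).completeSpace_coe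
  set u : A → vonNeumann π := fun a => ⟨act π a, act_mem_vonNeumann π a⟩
  let χ' : vonNeumann π →L[ℂ] ℂ := ⟨χ.toAlgHom.toLinearMap, hχ⟩
  have huY : Continuous fun a => u a * Y := hY.subtype_mk fun a => (u a * Y).2
  have hbd : ∀ a, ‖u a * Y‖ ≤ ‖Y‖ := fun a =>
    ContinuousLinearMap.opNorm_le_bound _ (norm_nonneg _) fun v => by
      change ‖act π a ((Y : E →L[ℂ] E) v)‖ ≤ _
      rw [norm_act_apply]
      exact (Y : E →L[ℂ] E).le_opNorm v
  have hint : Integrable (fun a => h a • (u a * Y)) μ := integrable_smul_of_continuous hh huY hbd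
  -- After multiplication by `Y` the strong integral becomes a Bochner integral in the algebra,
  -- through which `χ` can pass.
  have key : ∫ a, h a • (u a * Y) ∂μ = ⟨smear hπ hh, smear_mem_vonNeumann hπ hh⟩ * Y := by
    refine Subtype.ext (ContinuousLinearMap.ext fun v => ?_)
    let L : vonNeumann π →L[ℂ] E :=
      (ContinuousLinearMap.apply ℂ E v).comp (vonNeumann π).toSubalgebra.toSubmodule.subtypeL
    have h1 := L.integral_comp_comm hint
    change L (∫ a, h a • (u a * Y) ∂μ) = smear hπ hh ((Y : E →L[ℂ] E) v)
    rw [← h1]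
    rfl
  have h2 := χ'.integral_comp_comm hint
  have h3 : χ' (∫ a, h a • (u a * Y) ∂μ) =
      χ ⟨smear hπ hh, smear_mem_vonNeumann hπ hh⟩ * χ Y := by
    rw [key]; exact map_mul χ _ _
  have h4 : ∀ a, χ' (h a • (u a * Y)) = h a * χ (u a) * χ Y := fun a => by
    rw [map_smul, smul_eq_mul, mul_assoc]
    congr 1
    exact map_mul χ _ _
  simp only [h4, h3] at h2
  rw [integral_mul_const] at h2
  exact (mul_right_cancel₀ hχY h2).symm

end Smear

/-! ### Norm continuity from Haar smearing -/

section Haar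

variable {A E : Type*} [AddCommGroup A] [TopologicalSpace A] [IsTopologicalAddGroup A]
  [T2Space A] [MeasurableSpace A] [BorelSpace A] [NormedAddCommGroup E] [InnerProductSpace ℂ E] [CompleteSpace E]
  {π : Multiplicative A →* unitary (E →L[ℂ] E)} (hπ : ∀ v, Continuous fun a => act π a v)
  {H : Measure A} [H.IsAddHaarMeasure] [H.Regular]

theorem act_smear_apply {f : A → ℂ} (hf : Integrable f H) (a : A) (v : E) :
    act π a (smear hπ hf v) = ∫ x, f (-a + x) • act π x v ∂H := by
  rw [smear_apply, ← (act π a).integral_comp_comm (integrable_smul_act hπ hf v),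
    ← integral_add_left_eq_self (fun x => f (-a + x) • act π x v) a]
  simp [act_add_apply]

variable [LocallyCompactSpace A]

/-- The group acts norm-continuously on the operators smeared with Haar-integrable functions. -/
theorem continuous_act_mul_smear {f : A → ℂ} (hf : Integrable f H) :
    Continuous fun a => act π a * smear hπ hf := by
  set F : Lp ℂ 1 H := hf.toL1 f
  have hint : ∀ a, Integrable (fun x => f (-a + x)) H := fun a =>
    (measurePreserving_add_left H (-a)).integrable_comp_of_integrable hf
  have hF : ∀ a : A, DomAddAct.mk (-a) +ᵥ F = (hint a).toL1 _ := fun a => rfl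
  have hle : ∀ a b : A, ‖act π a * smear hπ hf - act π b * smear hπ hf‖ ≤
      ‖(DomAddAct.mk (-a) +ᵥ F) - (DomAddAct.mk (-b) +ᵥ F)‖ := fun a b => by
    rw [hF, hF, ← Integrable.toL1_sub _ _ (hint a) (hint b), L1.norm_of_fun_eq_integral_norm]
    refine ContinuousLinearMap.opNorm_le_bound _ (integral_nonneg fun _ => norm_nonneg _) fun v => ?_
    rw [sub_apply, mul_apply_eq_comp, mul_apply_eq_comp,
      act_smear_apply, act_smear_apply, ← integral_sub (integrable_smul_act hπ (hint a) v)
        (integrable_smul_act hπ (hint b) v), ← integral_mul_const]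
    refine (norm_integral_le_integral_norm _).trans_eq (integral_congr_ae
      (Eventually.of_forall fun x => ?_))
    simp only [← sub_smul, norm_smul, norm_act_apply, Pi.sub_apply]
  have : Fact ((1 : ENNReal) ≠ ⊤) := ⟨ENNReal.one_ne_top⟩
  have hc : Continuous fun a : A => DomAddAct.mk (-a) +ᵥ F :=
    ((DomAddAct.continuous_mk.comp continuous_neg).vadd continuous_const)
  refine continuous_iff_continuousAt.2 fun b => tendsto_iff_norm_sub_tendsto_zero.2 ?_
  exact squeeze_zero (fun _ => norm_nonneg _) (fun a => hle a b)
    (tendsto_iff_norm_sub_tendsto_zero.1 (hc.tendsto b))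

/-- Average over a compact neighbourhood of `0` on which `π a w` stays within `‖w‖ / 2` of `w`. By
convexity the average stays in that ball, which misses `0`. -/
theorem exists_smear_apply_ne_zero {w : E} (hw : w ≠ 0) :
    ∃ (f : A → ℂ) (hf : Integrable f H), smear hπ hf w ≠ 0 := by
  have hN : (fun a => act π a w) ⁻¹' Metric.closedBall w (‖w‖ / 2) ∈ 𝓝 (0 : A) := by
    refine (hπ w).continuousAt.preimage_mem_nhds ?_
    rw [act_zero]
    exact Metric.closedBall_mem_nhds _ (half_pos (norm_pos_iff.2 hw))
  obtain ⟨K, hK, hKN, hKc⟩ := local_compact_nhds hN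
  have hpos : H K ≠ 0 := (Measure.measure_pos_of_mem_nhds H hK).ne'
  have hf : Integrable (K.indicator fun _ => (1 : ℂ)) H :=
    (integrable_indicator_iff hKc.measurableSet).2 (integrableOn_const hKc.measure_ne_top)
  refine ⟨_, hf, fun h0 => ?_⟩
  have heq : (fun a => K.indicator (fun _ => (1 : ℂ)) a • act π a w) =
      K.indicator fun a => act π a w := by
    ext a; by_cases ha : a ∈ K <;> simp [ha]
  have hint : IntegrableOn (fun a => act π a w) K H := by
    rw [← integrable_indicator_iff hKc.measurableSet, ← heq]
    exact integrable_smul_act hπ hf w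
  have hmem := (convex_closedBall w (‖w‖ / 2)).set_average_mem Metric.isClosed_closedBall hpos
    hKc.measure_ne_top ((ae_restrict_iff' hKc.measurableSet).2 (Eventually.of_forall hKN)) hint
  rw [smear_apply, heq, integral_indicator hKc.measurableSet] at h0
  rw [setAverage_eq, h0, smul_zero, Metric.mem_closedBall, dist_zero_left] at hmem
  linarith [norm_pos_iff.2 hw]

/-- Every nonzero element of the von Neumann algebra of a strongly continuous unitary
representation is detected by a character of the algebra which is compatible with a continuous
character of the group. -/
theorem exists_dual_of_mem_vonNeumann (H : Measure A) [H.IsAddHaarMeasure] [H.Regular]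
    {X : vonNeumann π} (hX : X ≠ 0) :
    ∃ (χ : vonNeumann π →⋆ₐ[ℂ] ℂ) (φ : Dual A), χ X ≠ 0 ∧
      (∀ a, eval φ a = χ ⟨act π a, act_mem_vonNeumann π a⟩) ∧
      ∀ (μ : Measure A) [μ.InnerRegularCompactLTTop] (h : A → ℂ) (hh : Integrable h μ),
        χ ⟨smear hπ hh, smear_mem_vonNeumann hπ hh⟩ = ∫ a, h a * eval φ a ∂μ := by
  obtain ⟨v, hv⟩ : ∃ v, (X : E →L[ℂ] E) v ≠ 0 := by
    by_contra! h
    exact hX (Subtype.ext (ContinuousLinearMap.ext h))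
  obtain ⟨f, hf, hfv⟩ := exists_smear_apply_ne_zero hπ (H := H) hv
  set Y : vonNeumann π := ⟨smear hπ hf, smear_mem_vonNeumann hπ hf⟩
  -- A character not killing the product kills neither factor.
  have hYX : Y * X ≠ 0 := fun h => hfv (DFunLike.congr_fun (congrArg Subtype.val h) v)
  obtain ⟨χ, hχ, hne⟩ := exists_starAlgHom_ne_zero (vonNeumann π) (isClosed_vonNeumann π)
    (mul_comm_of_mem_vonNeumann π) hYX
  rw [map_mul] at hne
  have hχY : χ Y ≠ 0 := left_ne_zero_of_mul hne
  have hY := continuous_act_mul_smear hπ hf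
  obtain ⟨φ, hφ⟩ := exists_dual_eq hχ hχY hY
  refine ⟨χ, φ, right_ne_zero_of_mul hne, hφ, fun μ _ h hh => ?_⟩
  simp only [hφ]
  exact map_smear_eq_integral hπ hh hχ hχY hY

end Haar

/-! ### Uniform continuity of compactly supported functions -/

section UniformContinuity

variable {A : Type*} [AddCommGroup A] [TopologicalSpace A] [IsTopologicalAddGroup A]
  [LocallyCompactSpace A]

theorem exists_compact_nhds_forall_norm_sub_le {g : A → ℂ} (hg : Continuous g)
    (hgc : HasCompactSupport g) {ε : ℝ} (hε : 0 < ε) :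
    ∃ K ∈ 𝓝 (0 : A), IsCompact K ∧ ∀ a, ∀ x ∈ K, ‖g (a + x) - g a‖ ≤ ε := by
  let : UniformSpace A := IsTopologicalAddGroup.rightUniformSpace A
  have : IsUniformAddGroup A := isUniformAddGroup_of_addCommGroup
  have hu := hgc.uniformContinuous_of_continuous hg
  have hmem := hu (Metric.dist_mem_uniformity hε)
  rw [uniformity_eq_comap_nhds_zero A] at hmem
  obtain ⟨N, hN, hsub⟩ := hmem
  obtain ⟨K, hK, hKN, hKc⟩ := local_compact_nhds hN
  refine ⟨K, hK, hKc, fun a x hx => ?_⟩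
  have : (a, a + x) ∈ (fun p : A × A => (g p.1, g p.2)) ⁻¹' {p : ℂ × ℂ | dist p.1 p.2 < ε} :=
    hsub (by simpa using hKN hx)
  rw [← dist_eq_norm, dist_comm]
  exact le_of_lt this

end UniformContinuity

/-! ### The regular representation is faithful -/

section RegularRepresentation

variable {A : Type*} [AddCommGroup A] [TopologicalSpace A] [IsTopologicalAddGroup A]
  [MeasurableSpace A] [BorelSpace A] (H : Measure A) [H.IsAddHaarMeasure]

/-- Translation by `a` on `L²`. -/
noncomputable def translate (a : A) : Lp ℂ 2 H →ₗᵢ[ℂ] Lp ℂ 2 H :=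
  Lp.compMeasurePreservingₗᵢ ℂ (a +ᵥ ·) (measurePreserving_vadd a H)

theorem translate_apply (a : A) (v : Lp ℂ 2 H) : translate H a v = DomAddAct.mk a +ᵥ v := rfl

theorem translate_add (a b : A) (v : Lp ℂ 2 H) :
    translate H (a + b) v = translate H a (translate H b v) := by
  rw [add_comm]
  simp only [translate_apply, DomAddAct.mk_add, add_vadd]

theorem translate_zero (v : Lp ℂ 2 H) : translate H 0 v = v := by
  rw [translate_apply, DomAddAct.mk_zero, zero_vadd]

/-- The regular representation of `A` on `L²`. -/
noncomputable def regularRep : Multiplicative A →* unitary (Lp ℂ 2 H →L[ℂ] Lp ℂ 2 H) :=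
  (Unitary.linearIsometryEquiv (𝕜 := ℂ) (H := Lp ℂ 2 H)).symm.toMonoidHom.comp
    { toFun := fun a =>
        { toFun := translate H a.toAdd
          invFun := translate H (-a.toAdd)
          map_add' := map_add _
          map_smul' := map_smul _
          left_inv := fun v => by rw [← translate_add, neg_add_cancel, translate_zero]
          right_inv := fun v => by rw [← translate_add, add_neg_cancel, translate_zero]
          norm_map' := (translate H a.toAdd).norm_map }
      map_one' := LinearIsometryEquiv.ext (translate_zero H)
      map_mul' := fun a b => LinearIsometryEquiv.ext (translate_add H a.toAdd b.toAdd) }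

theorem act_regularRep_toLp (a : A) {g : A → ℂ} (hg : MemLp g 2 H) :
    act (regularRep H) a (hg.toLp g) =
      (hg.comp_measurePreserving (measurePreserving_vadd a H)).toLp (fun x => g (a + x)) := rfl

variable [LocallyCompactSpace A] [T2Space A] [H.Regular]

theorem continuous_act_regularRep (v : Lp ℂ 2 H) :
    Continuous fun a => act (regularRep H) a v :=
  have : Fact ((2 : ENNReal) ≠ ⊤) := ⟨ENNReal.ofNat_ne_top⟩
  DomAddAct.continuous_mk.vadd continuous_const

/-- Translate a bump equal to `1` at `0` and `0` at `b - a`, and compare at `-a`. Haar measure has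
full support, so a.e. equality is equality. -/
theorem act_regularRep_injective : Function.Injective (act (regularRep H)) := by
  intro a b hab
  by_contra hne
  have hba : b - a ≠ 0 := sub_ne_zero.2 (Ne.symm hne)
  obtain ⟨g, hg1, hgc, hgU, -⟩ := exists_continuousMap_one_of_isCompact_subset_isOpen
    (isCompact_singleton (x := (0 : A))) (isOpen_compl_singleton (x := b - a))
    (by simpa using hba)
  have hgC : Continuous fun x => (g x : ℂ) := by fun_prop
  have hg2 : MemLp (fun x => (g x : ℂ)) 2 H := hgC.memLp_of_hasCompactSupport
    (HasCompactSupport.comp_left (g := fun r : ℝ => (r : ℂ)) hgc (by simp))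
  have h := DFunLike.congr_fun hab (hg2.toLp _)
  rw [act_regularRep_toLp, act_regularRep_toLp, MemLp.toLp_eq_toLp_iff,
    Continuous.ae_eq_iff_eq H (by fun_prop) (by fun_prop)] at h
  have h0 := congrFun h (-a)
  have h1 : g 0 = 1 := hg1 rfl
  have h2 : g (b - a) = 0 := image_eq_zero_of_notMem_tsupport fun h => hgU h rfl
  simp only [add_neg_cancel, ← sub_eq_add_neg, h1, h2] at h0
  norm_num at h0

/-- Smearing the regular representation is injective. -/
theorem ae_eq_zero_of_smear_regularRep_eq_zero {μ : Measure A} [μ.Regular] {h : A → ℂ}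
    (hh : Integrable h μ) (h0 : smear (continuous_act_regularRep H) hh = 0) : h =ᵐ[μ] 0 := by
  refine ae_eq_zero_of_forall_integral_mul_eq_zero hh fun g hg hgc => ?_
  obtain ⟨C, hC⟩ := hgc.exists_bound_of_continuous hg
  refine norm_le_zero_iff.1 (le_of_forall_pos_le_add fun ε hε => ?_)
  set M := ∫ a, ‖h a‖ ∂μ
  have hM : 0 ≤ M := integral_nonneg fun _ => norm_nonneg _
  obtain ⟨K, hK, hKc, hKg⟩ :=
    -- `M + 1` avoids dividing by zero when `M = 0`.
    exists_compact_nhds_forall_norm_sub_le hg hgc (div_pos hε (by linarith : 0 < M + 1))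
  set c := H.real K
  have hc : 0 < c := ENNReal.toReal_pos (Measure.measure_pos_of_mem_nhds H hK).ne' hKc.measure_ne_top
  have hg2 : MemLp g 2 H := hg.memLp_of_hasCompactSupport hgc
  -- Pairing with the indicator of a small `K` replaces `g a` by `∫ x in K, g (a + x)`, which is
  -- within `ε / (M + 1) * c` of `c * g a`.
  set ℓ : Lp ℂ 2 H →L[ℂ] ℂ :=
    innerSL ℂ (indicatorConstLp 2 hKc.measurableSet hKc.measure_ne_top (1 : ℂ))
  have hℓ : ∀ a, ℓ (act (regularRep H) a (hg2.toLp g)) = ∫ x in K, g (a + x) ∂H := fun a => by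
    rw [innerSL_apply_apply, L2.inner_indicatorConstLp_one, act_regularRep_toLp]
    exact setIntegral_congr_ae hKc.measurableSet
      ((MemLp.coeFn_toLp _).mono fun x hx _ => hx)
  have hint := integrable_smul_act (continuous_act_regularRep H) hh (hg2.toLp g)
  have h1 : ∫ a, h a * ∫ x in K, g (a + x) ∂H ∂μ = 0 := by
    have h2 := ℓ.integral_comp_comm hint
    rw [show ∫ a, h a • act (regularRep H) a (hg2.toLp g) ∂μ = 0 from DFunLike.congr_fun h0 _,
      map_zero] at h2
    rw [← h2]
    exact integral_congr_ae (Eventually.of_forall fun a => by simp [hℓ])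
  have hint1 : Integrable (fun a => h a * ∫ x in K, g (a + x) ∂H) μ := by
    refine (ℓ.integrable_comp hint).congr (Eventually.of_forall fun a => by simp [hℓ])
  have hint2 : Integrable (fun a => h a * g a) μ := integrable_smul_of_continuous hh hg hC
  have hbd : ∀ a, ‖(∫ x in K, g (a + x) ∂H) - c * g a‖ ≤ ε / (M + 1) * c := fun a => by
    have h3 : (c : ℂ) * g a = ∫ _ in K, g a ∂H := by simp [c]
    have h4 : IntegrableOn (fun x => g (a + x)) K H :=
      (by fun_prop : Continuous fun x => g (a + x)).continuousOn.integrableOn_compact hKc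
    rw [h3, ← integral_sub h4 (integrableOn_const hKc.measure_ne_top)]
    exact norm_setIntegral_le_of_norm_le_const hKc.measure_lt_top fun x hx => hKg a x hx
  have h5 : (c : ℂ) * ∫ a, h a * g a ∂μ =
      -∫ a, h a * ((∫ x in K, g (a + x) ∂H) - c * g a) ∂μ := by
    have : ∀ a, h a * ((∫ x in K, g (a + x) ∂H) - c * g a) =
        (h a * ∫ x in K, g (a + x) ∂H) - c * (h a * g a) := fun a => by ring
    simp only [this]
    rw [integral_sub hint1 (hint2.const_mul _), h1, integral_const_mul, zero_sub, neg_neg]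
  have h6 : c * ‖∫ a, h a * g a ∂μ‖ ≤ c * ε := by
    calc c * ‖∫ a, h a * g a ∂μ‖ = ‖(c : ℂ) * ∫ a, h a * g a ∂μ‖ := by
          rw [norm_mul, Complex.norm_real, Real.norm_of_nonneg hc.le]
      _ ≤ ∫ a, ‖h a‖ * (ε / (M + 1) * c) ∂μ := by
          rw [h5, norm_neg]
          refine norm_integral_le_of_norm_le (hh.norm.mul_const _)
            (Eventually.of_forall fun a => ?_)
          rw [norm_mul]
          exact mul_le_mul_of_nonneg_left (hbd a) (norm_nonneg _)
      _ = c * ε * (M / (M + 1)) := by rw [integral_mul_const]; ring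
      _ ≤ c * ε := mul_le_of_le_one_right (by positivity)
          (div_le_one_of_le₀ (by linarith) (by linarith))
  rw [zero_add]
  exact le_of_mul_le_mul_left h6 hc

/-- The Fourier transform of an integrable density with respect to a regular measure is
injective. -/
theorem exists_dual_integral_mul_eval_ne_zero {μ : Measure A} [μ.Regular] {h : A → ℂ}
    (hh : Integrable h μ) (hne : ¬ h =ᵐ[μ] 0) :
    ∃ φ : Dual A, ∫ a, h a * starRingEnd ℂ (eval φ a) ∂μ ≠ 0 := by
  obtain ⟨K₀⟩ : Nonempty (TopologicalSpace.PositiveCompacts A) := inferInstance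
  set H := Measure.addHaarMeasure K₀
  have hX : (⟨_, smear_mem_vonNeumann (continuous_act_regularRep H) hh⟩ :
      vonNeumann (regularRep H)) ≠ 0 := fun h0 =>
    hne (ae_eq_zero_of_smear_regularRep_eq_zero H hh (congrArg Subtype.val h0))
  obtain ⟨χ, φ, hχ, -, hφ⟩ :=
    exists_dual_of_mem_vonNeumann (continuous_act_regularRep H) H hX
  rw [hφ μ h hh] at hχ
  -- The inverse character absorbs the conjugate in the Fourier transform.
  refine ⟨φ⁻¹, ?_⟩
  have : ∀ a, starRingEnd ℂ (eval φ⁻¹ a) = eval φ a := fun a => by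
    have : eval φ⁻¹ a = starRingEnd ℂ (eval φ a) := Circle.coe_inv_eq_conj _
    rw [this, Complex.conj_conj]
  simpa only [this] using hχ

theorem exists_dual_eval_ne {a b : A} (hab : a ≠ b) : ∃ φ : Dual A, eval φ a ≠ eval φ b := by
  obtain ⟨K₀⟩ : Nonempty (TopologicalSpace.PositiveCompacts A) := inferInstance
  set H := Measure.addHaarMeasure K₀
  set u : A → vonNeumann (regularRep H) := fun a => ⟨act _ a, act_mem_vonNeumann _ a⟩
  have hX : u a - u b ≠ 0 := sub_ne_zero.2 fun h => by
    have h1 := congrArg Subtype.val h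
    exact hab (act_regularRep_injective H h1)
  obtain ⟨χ, φ, hχ, hφ, -⟩ :=
    exists_dual_of_mem_vonNeumann (continuous_act_regularRep H) H hX
  refine ⟨φ, ?_⟩
  rw [hφ, hφ]
  rw [map_sub] at hχ
  exact sub_ne_zero.1 hχ

end RegularRepresentation

/-! ### Polar decomposition of a complex measure -/

section ComplexMeasure

variable {X : Type*} [MeasurableSpace X] (ν : ComplexMeasure X)

theorem absolutelyContinuous_of_forall_variation {s : SignedMeasure X}
    (hs : ∀ t, ν t = 0 → s t = 0) : s ≪ᵥ ν.variation.toENNRealVectorMeasure := by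
  intro t ht
  by_cases htm : MeasurableSet t
  · rw [Measure.toENNRealVectorMeasure_apply_measurable htm] at ht
    refine hs t (enorm_eq_zero.1 (le_antisymm ?_ bot_le))
    exact (ν.enorm_measure_le_variation t).trans ht.le
  · exact s.not_measurable htm

/-- Radon–Nikodym, applied to the real and imaginary parts. -/
theorem withDensityᵥ_rnDeriv_variation : ν.variation.withDensityᵥ (ν.rnDeriv ν.variation) = ν := by
  have := isFiniteMeasure_variation ν
  have hi := ν.integrable_rnDeriv ν.variation
  have hre : ν.variation.withDensityᵥ ((ComplexMeasure.re ν).rnDeriv ν.variation) =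
      ComplexMeasure.re ν :=
    SignedMeasure.withDensityᵥ_rnDeriv_eq _ _ (absolutelyContinuous_of_forall_variation ν
      fun t ht => show (ν t).re = 0 by rw [ht, Complex.zero_re])
  have him : ν.variation.withDensityᵥ ((ComplexMeasure.im ν).rnDeriv ν.variation) =
      ComplexMeasure.im ν :=
    SignedMeasure.withDensityᵥ_rnDeriv_eq _ _ (absolutelyContinuous_of_forall_variation ν
      fun t ht => show (ν t).im = 0 by rw [ht, Complex.zero_im])
  ext i hi' : 1
  rw [withDensityᵥ_apply hi hi']
  apply Complex.ext
  · rw [← RCLike.re_eq_complex_re, ← integral_re hi.integrableOn, RCLike.re_eq_complex_re]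
    change _ = ComplexMeasure.re ν i
    rw [← hre, withDensityᵥ_apply (SignedMeasure.integrable_rnDeriv _ _) hi']
    rfl
  · rw [← RCLike.im_eq_complex_im, ← integral_im hi.integrableOn, RCLike.im_eq_complex_im]
    change _ = ComplexMeasure.im ν i
    rw [← him, withDensityᵥ_apply (SignedMeasure.integrable_rnDeriv _ _) hi']
    rfl

/-- The density of a complex measure with respect to its variation has modulus `1`. -/
theorem norm_rnDeriv_variation :
    ∀ᵐ x ∂ν.variation, ‖ν.rnDeriv ν.variation x‖ = 1 := by
  have := isFiniteMeasure_variation ν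
  have hi := ν.integrable_rnDeriv ν.variation
  -- The variation of `h |ν|` is `‖h‖ |ν|`, so `‖h‖` and `1` are densities of the same finite
  -- measure.
  have h := Measure.variation_withDensityᵥ hi
  rw [withDensityᵥ_rnDeriv_variation] at h
  have h1 : ν.variation.withDensity (fun x => ‖ν.rnDeriv ν.variation x‖ₑ) =
      ν.variation.withDensity 1 := by rw [← h, withDensity_one]
  have h2 := (withDensity_eq_iff_of_sigmaFinite hi.aestronglyMeasurable.enorm
    aemeasurable_const).1 h1
  filter_upwards [h2] with x hx
  rw [← toReal_enorm, hx]
  simp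

/-- Both sides are additive and `L¹`-continuous in `f`, and they agree on indicators. -/
theorem integral_mul_eq_integral_rnDeriv {f : X → ℂ} (hf : Integrable f ν.variation) :
    ν.integral f (ContinuousLinearMap.mul ℝ ℂ) =
      ∫ x, ν.rnDeriv ν.variation x * f x ∂ν.variation := by
  have := isFiniteMeasure_variation ν
  set h := ν.rnDeriv ν.variation
  have hi : Integrable h ν.variation := ν.integrable_rnDeriv ν.variation
  have hnorm : ∀ᵐ x ∂ν.variation, ‖h x‖ = 1 := norm_rnDeriv_variation ν
  have hint : ∀ {f : X → ℂ}, Integrable f ν.variation →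
      Integrable (fun x => h x * f x) ν.variation := fun hf =>
    hf.bdd_mul (c := 1) hi.aestronglyMeasurable (hnorm.mono fun x hx => hx.le)
  refine Integrable.induction (fun f => ν.integral f (ContinuousLinearMap.mul ℝ ℂ) =
    ∫ x, h x * f x ∂ν.variation) (fun c s hs _ => ?_) (fun f g _ hf hg h1 h2 => ?_) ?_
    (fun f g hfg _ h1 => ?_) hf
  · have h1 : (fun x => h x * s.indicator (fun _ => c) x) = s.indicator fun x => h x * c := by
      ext x; by_cases hx : x ∈ s <;> simp [hx]
    rw [VectorMeasure.integral_indicator_const _ hs, h1, integral_indicator hs,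
      integral_mul_const, ← withDensityᵥ_apply hi hs, withDensityᵥ_rnDeriv_variation,
      ContinuousLinearMap.mul_apply', mul_comm]
  · rw [VectorMeasure.integral_add hf hg, h1, h2, ← integral_add (hint hf) (hint hg)]
    simp [mul_add]
  · refine isClosed_eq VectorMeasure.continuous_integral ?_
    refine LipschitzWith.continuous (K := 1) (LipschitzWith.of_dist_le_mul fun f g => ?_)
    rw [NNReal.coe_one, one_mul, dist_eq_norm, dist_eq_norm, L1.norm_eq_integral_norm,
      ← integral_sub (hint (L1.integrable_coeFn f)) (hint (L1.integrable_coeFn g))]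
    refine norm_integral_le_of_norm_le (L1.integrable_coeFn _).norm ?_
    filter_upwards [hnorm, Lp.coeFn_sub f g] with x hx hx2
    rw [hx2, ← mul_sub, norm_mul, hx, one_mul, Pi.sub_apply]
  · rw [← VectorMeasure.integral_congr_ae hfg, h1]
    exact integral_congr_ae (hfg.mono fun x hx => by simp only [hx])

end ComplexMeasure

end LCAFourier

theorem mainTheorem1 {A : Type*} [AddCommGroup A] [TopologicalSpace A] [IsTopologicalAddGroup A]
    [LocallyCompactSpace A] [T2Space A] [MeasurableSpace A] [BorelSpace A] :
    (∀ (H : Measure A) [H.IsAddHaarMeasure] [H.Regular] (θ : A → ℂ), Integrable θ H →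
      ¬ θ =ᵐ[H] 0 → ∃ φ : LCAFourier.Dual A, LCAFourier.fourierFun H θ φ ≠ 0) ∧
    (∀ ν : ComplexMeasure A, LCAFourier.IsRegularComplex ν → ν ≠ 0 →
      ∃ φ : LCAFourier.Dual A, LCAFourier.fourierMeas ν φ ≠ 0) ∧
    (∀ a b : A, a ≠ b →
      ∃ φ : LCAFourier.Dual A, LCAFourier.eval φ a ≠ LCAFourier.eval φ b) := by
  refine ⟨fun H _ _ θ hθ hne => LCAFourier.exists_dual_integral_mul_eval_ne_zero hθ hne,
    fun ν hν hne => ?_, fun a b hab => LCAFourier.exists_dual_eval_ne hab⟩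
  have : ν.variation.Regular := hν
  obtain ⟨φ, hφ⟩ := LCAFourier.exists_dual_integral_mul_eval_ne_zero
    -- A density that is a.e. both zero and of modulus `1` forces `|ν| = 0`.
    (ν.integrable_rnDeriv ν.variation) fun h0 => hne <| VectorMeasure.variation_eq_zero.1 <| by
      rw [← ae_eq_bot, ← Filter.eventually_false_iff_eq_bot]
      filter_upwards [h0, LCAFourier.norm_rnDeriv_variation ν] with x hx hx1
      simp [hx] at hx1
  refine ⟨φ, ?_⟩
  rwa [LCAFourier.fourierMeas,
    LCAFourier.integral_mul_eq_integral_rnDeriv ν (LCAFourier.integrable_fourierMeas ν φ)]
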